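/- Let $(X,d)$ be a (possibly infinite) metric space. Write $E(X,d)$ for the set of all $f\colon X\to\mathbb R$ with $f(x)=\sup_{y\in X}(d(x,y)-f(y))$ for all $x\in X$, endowed with the metric $d_\infty(f,g)=\|f-g\|_\infty$. Any two elements of $E(X,d)$ differ by a bounded function, and $x\mapsto d_x:=d(x,\cdot)$ embeds $X$ isometrically into $E(X,d)$. For $f\in\mathbb R^X$ let $A(f)$ be the set of unordered pairs $\{x,y\}$ (possibly $x=y$) with $f(x)+f(y)=d(x,y)$; for a set $A$ of such pairs let $H(A)=\{g\in\mathbb R^X: g(x)+g(y)=d(x,y)\text{ for all }\{x,y\}\in A\}$ and $\operatorname{rank}(A)=\dim H(A)\in\mathbb N\cup\{0,\infty\}$. Let $E'(X,d)$ be the set of all $f\in\mathbb R^X$ with $f(x)+f(y)\ge d(x,y)$ for all $x,y\in X$ and $\bigcup A(f)=X$. The space $(X,d)$ satisfies the local rank condition (LRC) if for every $f\in E(X,d)$ there are $\varepsilon,N>0$ such that $\operatorname{rank}(A(g))\le N$ for all $g\in E'(X,d)$ with $\|f-g\|_\infty<\varepsilon$. For $f\in E(X,d)$ the cell of $f$ is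 $[f]=E(X,d)\cap H(A(f))$. A gate of $x\in X$ in $[f]$ is an element $\gamma\in[f]$ with $d_\infty(d_x,g)=d_\infty(d_x,\gamma)+d_\infty(\gamma,g)$ for all $g\in[f]$; it is unique if it exists, and is then denoted $\gamma^x$. The cell $[f]$ is called $X$-gated if every $x\in X$ has a gate in $[f]$; in this case $G([f])=\{\gamma^x:x\in X\}$. A metric space $(Y,\rho)$ is called antipodal if there is an involution $\sigma\colon Y\to Y$ (that is, $\sigma\circ\sigma=\mathrm{id}$) with $\rho(x,\sigma(x))=\rho(x,y)+\rho(y,\sigma(x))$ for all $x,y\in Y$. **Theorem.** Let $(X,d)$ be a metric space with integer-valued metric satisfying the (LRC), and let $f\in E(X,d)$ be such that $[f]$ is $X$-gated. Then: (i) $(G([f]),d_\infty)$ is an antipodal metric space. (ii) The map $\Phi\colon([f],d_\infty)\to E(G([f]),d_\infty)$ given by $$g\mapsto\bigl(\gamma^x\mapsto g(x)-\gamma^x(x)\bigr)$$ is well defined, is a bijective isometry, and is an isomorphism of polytopes: $[f]\subset\mathbb R^X$ and $E(G([f]),d_\infty)\subset\mathbb R^{G([f])}$ are convex hulls of finite sets,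 $\Phi$ is the restriction of an affine map that is injective on the affine hull of $[f]$, and a subset of $[f]$ is a face of $[f]$ if and only if its image under $\Phi$ is a face of $E(G([f]),d_\infty)$. -/

import Mathlib

/-! ### Isbell's injective hull -/

/-- `f` lies in `E(X,d)`: for every `x`, `f x` is the supremum of `d(x,y) - f(y)` over `y ∈ X`. -/
def IsExtremal {X : Type*} [MetricSpace X] (f : X → ℝ) : Prop :=
  ∀ x, IsLUB (Set.range fun y => dist x y - f y) (f x)

/-- The sup-distance `‖f - g‖_∞` of two real functions (only used when `f - g` is bounded). -/
noncomputable def supDist {X : Type*} (f g : X → ℝ) : ℝ := ⨆ x, |f x - g x|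

/-- The injective hull `E(X,d)`. -/
def InjHull (X : Type*) [MetricSpace X] : Type _ := {f : X → ℝ // IsExtremal f}

instance InjHull.instCoeFun {X : Type*} [MetricSpace X] :
    CoeFun (InjHull X) (fun _ => X → ℝ) := ⟨Subtype.val⟩

theorem IsExtremal.dist_le_add {X : Type*} [MetricSpace X] {f : X → ℝ} (hf : IsExtremal f)
    (x y : X) : dist x y ≤ f x + f y := by
  have := (hf x).1 ⟨y, rfl⟩
  simp only at this
  linarith

theorem IsExtremal.le_add_dist {X : Type*} [MetricSpace X] {f : X → ℝ} (hf : IsExtremal f)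
    (x y : X) : f x ≤ f y + dist x y := by
  refine (hf x).2 ?_
  rintro _ ⟨z, rfl⟩
  have h1 := hf.dist_le_add y z
  have h2 := dist_triangle x y z
  simp only
  linarith

theorem IsExtremal.bddAbove_abs_sub {X : Type*} [MetricSpace X] {f g : X → ℝ}
    (hf : IsExtremal f) (hg : IsExtremal g) : BddAbove (Set.range fun x => |f x - g x|) := by
  rcases isEmpty_or_nonempty X with h | ⟨⟨y⟩⟩
  · simp
  · refine ⟨f y + g y, ?_⟩
    rintro _ ⟨x, rfl⟩
    have h1 := hf.dist_le_add x y
    have h2 := hg.dist_le_add x y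
    have h3 := hf.le_add_dist x y
    have h4 := hg.le_add_dist x y
    simp only
    rw [abs_le]
    constructor <;> linarith

/-- `E(X,d)` with the metric `d_∞(f,g) = ‖f - g‖_∞`. -/
noncomputable instance InjHull.instMetricSpace {X : Type*} [MetricSpace X] :
    MetricSpace (InjHull X) where
  dist f g := supDist f.1 g.1
  dist_self f := by simp [supDist]
  dist_comm f g := by simp only [supDist, abs_sub_comm]
  dist_triangle f g h := by
    rcases isEmpty_or_nonempty X with hX | hX
    · simp [supDist]
    · refine ciSup_le fun x => (abs_sub_le _ (g.1 x) _).trans ?_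
      exact add_le_add (le_ciSup (f.2.bddAbove_abs_sub g.2) x)
        (le_ciSup (g.2.bddAbove_abs_sub h.2) x)
  eq_of_dist_eq_zero := by
    intro f g hfg
    change supDist f.1 g.1 = 0 at hfg
    refine Subtype.ext (funext fun x => ?_)
    have h := le_ciSup (f.2.bddAbove_abs_sub g.2) x
    have h0 : |f.1 x - g.1 x| ≤ 0 := h.trans hfg.le
    exact sub_eq_zero.1 (abs_nonpos_iff.1 h0)

/-- The canonical embedding `x ↦ d_x = d(x, ·)` of `X` into `E(X,d)`. -/
def InjHull.embed {X : Type*} [MetricSpace X] (x : X) : InjHull X :=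
  ⟨fun y => dist x y, fun z => by
    constructor
    · rintro _ ⟨y, rfl⟩
      have := dist_triangle z x y
      rw [dist_comm z x] at this
      simp only
      linarith
    · intro b hb
      have := hb ⟨x, rfl⟩
      simpa [dist_comm] using this⟩

/-! ### Tight pairs, rank, cells, the local rank condition -/

/-- `A(f)`: the unordered pairs `{x,y}` (possibly `x = y`) with `f(x) + f(y) = d(x,y)`. -/
def tightPairs {X : Type*} [MetricSpace X] (f : X → ℝ) : Set (Sym2 X) :=
  {e | ∃ x y : X, e = s(x, y) ∧ f x + f y = dist x y}

/-- `E'(X,d)`: the `f` with `f(x) + f(y) ≥ d(x,y)` for all `x, y` and `⋃ A(f) = X`. -/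
def IsTightExtremal {X : Type*} [MetricSpace X] (f : X → ℝ) : Prop :=
  (∀ x y, dist x y ≤ f x + f y) ∧ ∀ x : X, ∃ e ∈ tightPairs f, x ∈ e

/-- The affine subspace `H(A) = {g : g(x) + g(y) = d(x,y) for all {x,y} ∈ A}` of `ℝ^X`. -/
def tightSubspace {X : Type*} [MetricSpace X] (A : Set (Sym2 X)) :
    AffineSubspace ℝ (X → ℝ) where
  carrier := {g | ∀ x y : X, s(x, y) ∈ A → g x + g y = dist x y}
  smul_vsub_vadd_mem' := by
    intro c p q r hp hq hr x y hxy
    have h1 := hp x y hxy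
    have h2 := hq x y hxy
    have h3 := hr x y hxy
    simp only [vsub_eq_sub, vadd_eq_add, Pi.add_apply, Pi.smul_apply, Pi.sub_apply, smul_eq_mul]
    linear_combination c * h1 - c * h2 + h3

/-- `rank(A) = dim H(A) ∈ ℕ ∪ {∞}`. -/
noncomputable def tightRank {X : Type*} [MetricSpace X] (A : Set (Sym2 X)) : ℕ∞ :=
  Cardinal.toENat (Module.rank ℝ (tightSubspace A).direction)

/-- The local rank condition (LRC). -/
def LocalRankCondition (X : Type*) [MetricSpace X] : Prop :=
  ∀ f : X → ℝ, IsExtremal f → ∃ ε : ℝ, 0 < ε ∧ ∃ N : ℕ, ∀ g : X → ℝ,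
    IsTightExtremal g → supDist f g < ε → tightRank (tightPairs g) ≤ N

/-- The cell `[f] = E(X,d) ∩ H(A(f))`. -/
def cell {X : Type*} [MetricSpace X] (f : InjHull X) : Set (InjHull X) :=
  {g | (g : X → ℝ) ∈ tightSubspace (tightPairs (f : X → ℝ))}

/-! ### Gates and antipodal spaces -/

/-- `γ` is a gate of `x` in `Z ⊆ Y`, with respect to the map `i : X → Y`. -/
def IsGate {X Y : Type*} [MetricSpace Y] (i : X → Y) (Z : Set Y) (x : X) (γ : Y) : Prop :=
  γ ∈ Z ∧ ∀ z ∈ Z, dist (i x) z = dist (i x) γ + dist γ z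

/-- `Z ⊆ Y` is `X`-gated. -/
def IsGated {X Y : Type*} [MetricSpace Y] (i : X → Y) (Z : Set Y) : Prop :=
  ∀ x : X, ∃ γ : Y, IsGate i Z x γ

/-- The set of all `X`-gates of `Z`. -/
def gates {X Y : Type*} [MetricSpace Y] (i : X → Y) (Z : Set Y) : Set Y :=
  {γ | ∃ x : X, IsGate i Z x γ}

/-- A metric space is antipodal if it has an involution `σ` such that every point lies between
`x` and `σ x`, for every `x`. -/
def IsAntipodal (X : Type*) [MetricSpace X] : Prop :=
  ∃ σ : X → X, Function.Involutive σ ∧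
    ∀ x y : X, dist x (σ x) = dist x y + dist y (σ x)

/-! ### Polytopes -/

/-- A (convex) polytope: the convex hull of a finite set of points. -/
def IsPolytope {V : Type*} [AddCommGroup V] [Module ℝ V] (P : Set V) : Prop :=
  ∃ S : Set V, S.Finite ∧ P = convexHull ℝ S

/-- A face of a convex set (the empty face and the improper face are allowed). -/
def IsFace {V : Type*} [AddCommGroup V] [Module ℝ V] (P F : Set V) : Prop :=
  Convex ℝ F ∧ IsExtreme ℝ P F

/-- The affine map `L` restricts to an isomorphism from the polytope `P` onto the polytope `Q`:
it is injective on the affine hull of `P`, maps `P` onto `Q`, and induces a bijection between the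
faces of `P` and the faces of `Q`. -/
structure IsPolytopeIso {V W : Type*} [AddCommGroup V] [Module ℝ V] [AddCommGroup W] [Module ℝ W]
    (L : V →ᵃ[ℝ] W) (P : Set V) (Q : Set W) : Prop where
  isPolytope_source : IsPolytope P
  isPolytope_target : IsPolytope Q
  injOn : Set.InjOn L (affineSpan ℝ P : Set V)
  image_eq : L '' P = Q
  face_iff : ∀ F : Set V, F ⊆ P → (IsFace P F ↔ IsFace Q (L '' F))

/-! A function that is odd along the tight pairs of `f` (its values at `x` and `y` are opposite
whenever `{x, y} ∈ A(f)`) may be composed with any odd real function, and the result lies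
in the direction of `H(A(f))`. Hence the number of values of such a function, up to sign and
2-torsion, is at most `rank (A(f))`.

If `d` is integral, the reduction of `f` modulo `1` is odd along tight pairs. Every extremal `f` is
a uniform limit of functions in `E'(X,d)` with values in `(1/n)ℤ`, obtained from minimal integral
functions for the metric `n d`, so the local rank condition leaves `f` only finitely many values
modulo `1`. The suprema defining `f` are therefore attained: `E(X,d) = E'(X,d)`.

The coordinates, as functionals on the direction of `H(A(f))`, are odd along tight pairs too. So if
`A(f)` has finite rank there are only finitely many of them up to equality, and the cell `[f]` is a
compact set cut out by inequalities with finitely many normals: it has finitely many extreme points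
and is a polytope by Krein–Milman.

If `{x, y} ∈ A(f)`, then the gates of `x` and `y` in `[f]` are antipodal in `G([f])`. On the cell
`Φ(g)` is the distance function `γ ↦ d_∞(γ, g)`, and its inverse extends a function `φ` on the gates
to `x ↦ φ(γ^x) + γ^x(x)`. -/

open Filter Topology

section TightFunctions

variable {X : Type*} [MetricSpace X] {f g : X → ℝ}

theorem mk_mem_tightPairs {x y : X} : s(x, y) ∈ tightPairs f ↔ f x + f y = dist x y := by
  refine ⟨fun ⟨a, b, hab, h⟩ => ?_, fun h => ⟨x, y, rfl, h⟩⟩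
  rcases Sym2.eq_iff.1 hab with ⟨rfl, rfl⟩ | ⟨rfl, rfl⟩
  · exact h
  · rw [add_comm, dist_comm, h]

theorem isTightExtremal_iff : IsTightExtremal f ↔
    (∀ x y, dist x y ≤ f x + f y) ∧ ∀ x, ∃ y, f x + f y = dist x y := by
  refine and_congr_right fun _ => forall_congr' fun x => ⟨?_, ?_⟩
  · rintro ⟨_, hxy, y, rfl⟩
    exact ⟨y, mk_mem_tightPairs.1 hxy⟩
  · rintro ⟨y, hxy⟩
    exact ⟨s(x, y), mk_mem_tightPairs.2 hxy, Sym2.mem_mk_left x y⟩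

theorem IsTightExtremal.exists_tight (hf : IsTightExtremal f) (x : X) :
    ∃ y, f x + f y = dist x y :=
  (isTightExtremal_iff.1 hf).2 x

theorem IsTightExtremal.isExtremal (hf : IsTightExtremal f) : IsExtremal f := by
  refine fun x => ⟨?_, fun b hb => ?_⟩
  · rintro _ ⟨y, rfl⟩
    exact sub_le_iff_le_add.2 (hf.1 x y)
  · obtain ⟨y, hy⟩ := hf.exists_tight x
    exact (eq_sub_of_add_eq hy).trans_le (hb ⟨y, rfl⟩)

theorem IsExtremal.nonneg (hf : IsExtremal f) (x : X) : 0 ≤ f x := by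
  have := hf.dist_le_add x x
  rw [dist_self] at this
  linarith

theorem IsExtremal.abs_sub_le {ε : ℝ} (hf : IsExtremal f) (hg : ∀ x y, dist x y ≤ g x + g y)
    (hgf : ∀ x, g x ≤ f x + ε) (x : X) : |f x - g x| ≤ ε := by
  have hfg : f x ≤ g x + ε := by
    refine (hf x).2 ?_
    rintro _ ⟨y, rfl⟩
    linarith [hg x y, hgf y]
  exact abs_le.2 ⟨by linarith [hgf x], by linarith⟩

theorem mem_tightSubspace :
    g ∈ tightSubspace (tightPairs f) ↔ ∀ x y, f x + f y = dist x y → g x + g y = dist x y :=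
  ⟨fun h x y hxy => h x y (mk_mem_tightPairs.2 hxy),
    fun h x y hxy => h x y (mk_mem_tightPairs.1 hxy)⟩

/-- The direction of the affine space `H(A(f))`; its dimension is the rank of `A(f)`. -/
abbrev tightDirection (f : X → ℝ) : Submodule ℝ (X → ℝ) :=
  (tightSubspace (tightPairs f)).direction

theorem mem_tightDirection {w : X → ℝ} :
    w ∈ tightDirection f ↔ ∀ x y, f x + f y = dist x y → w x + w y = 0 := by
  rw [← AffineSubspace.vadd_mem_iff_mem_direction w (mem_tightSubspace.2 fun _ _ h => h),
    mem_tightSubspace]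
  refine forall₂_congr fun x y => forall_congr' fun hxy => ?_
  rw [← hxy, vadd_eq_add, Pi.add_apply, Pi.add_apply, add_add_add_comm, add_eq_right]

theorem finiteDimensional_tightDirection (hrank : tightRank (tightPairs f) < ⊤) :
    FiniteDimensional ℝ (tightDirection f) :=
  Module.rank_lt_aleph0_iff.1 (Cardinal.toENat_lt_top.1 hrank)

end TightFunctions

section SignSeparated

variable {ι Γ : Type*} [AddCommGroup Γ]

/-- The elements `u i` and `-u j` of `Γ` are pairwise distinct. For functions that are odd along
the tight pairs this is the condition under which values can be varied independently. -/
def SignSeparated (u : ι → Γ) : Prop :=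
  Function.Injective u ∧ ∀ i j, u i ≠ -u j

theorem eventually_ne_of_tendsto {α Y : Type*} [TopologicalSpace Y] [T2Space Y] {l : Filter α}
    {u v : α → Y} {a b : Y} (hu : Tendsto u l (𝓝 a)) (hv : Tendsto v l (𝓝 b)) (hab : a ≠ b) :
    ∀ᶠ t in l, u t ≠ v t :=
  (hu.prodMk_nhds hv).eventually (isClosed_diagonal.isOpen_compl.mem_nhds hab)

theorem SignSeparated.eventually [Finite ι] [TopologicalSpace Γ] [ContinuousNeg Γ] [T2Space Γ]
    {α : Type*} {l : Filter α} {u : ι → Γ} {v : α → ι → Γ} (hu : SignSeparated u)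
    (hv : Tendsto v l (𝓝 u)) : ∀ᶠ a in l, SignSeparated (v a) := by
  have hlim := tendsto_pi_nhds.1 hv
  have hinj : ∀ᶠ a in l, ∀ i j, i ≠ j → v a i ≠ v a j :=
    eventually_all.2 fun i => eventually_all.2 fun j => eventually_imp_distrib_left.2 fun hij =>
      eventually_ne_of_tendsto (hlim i) (hlim j) (hu.1.ne hij)
  have hneg : ∀ᶠ a in l, ∀ i j, v a i ≠ -v a j :=
    eventually_all.2 fun i => eventually_all.2 fun j =>
      eventually_ne_of_tendsto (hlim i) (hlim j).neg (hu.2 i j)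
  filter_upwards [hinj, hneg] with a ha ha'
  exact ⟨fun i j hij => not_imp_not.1 (ha i j) hij, ha'⟩

theorem finite_range_of_signSeparated_le {X : Type*} {c : X → Γ} {N : ℕ}
    (htors : {a : Γ | a = -a}.Finite)
    (hN : ∀ (m : ℕ) (x : Fin m → X), SignSeparated (c ∘ x) → m ≤ N) : (Set.range c).Finite := by
  by_contra hinf
  obtain ⟨x, hself, hpair⟩ := exists_seq_of_forall_finset_exists (fun x => c x ≠ -c x)
    (fun x y => c x ≠ c y ∧ c x ≠ -c y) fun s _ => by
      obtain ⟨_, ⟨y, rfl⟩, hy⟩ := (Set.Infinite.sdiff hinf <| htors.union <|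
        (s.finite_toSet.image c).union (s.finite_toSet.image (-c))).nonempty
      refine ⟨y, fun h => hy (.inl h), fun z hz => ⟨fun h => ?_, fun h => ?_⟩⟩
      · exact hy (.inr (.inl ⟨z, hz, h⟩))
      · exact hy (.inr (.inr ⟨z, hz, neg_eq_iff_eq_neg.2 h⟩))
  have hsep : SignSeparated (c ∘ x ∘ (Fin.val : Fin (N + 1) → ℕ)) := by
    refine ⟨.of_lt_imp_ne fun i j hij => (hpair i j hij).1, fun i j => ?_⟩
    · rcases lt_trichotomy i j with hij | rfl | hij
      · exact (hpair i j hij).2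
      · exact hself i
      · exact fun h => (hpair j i hij).2 (neg_eq_iff_eq_neg.1 h.symm)
  exact absurd (hN (N + 1) _ hsep) (by omega)

/-- The odd function on `Γ` with value `1` at `c` and `-1` at `-c` that vanishes elsewhere
(identically zero if `c = -c`). -/
noncomputable def oddIndicator (c a : Γ) : ℝ :=
  open Classical in (if a = c then 1 else 0) - (if a = -c then 1 else 0)

theorem oddIndicator_neg (c a : Γ) : oddIndicator c (-a) = -oddIndicator c a := by
  classical simp only [oddIndicator, neg_eq_iff_eq_neg, neg_neg, neg_sub]

theorem SignSeparated.oddIndicator_apply [DecidableEq ι] {u : ι → Γ} (hu : SignSeparated u)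
    (i j : ι) : oddIndicator (u i) (u j) = (Pi.single i 1 : ι → ℝ) j := by
  simp only [oddIndicator, hu.1.eq_iff, hu.2 j i, if_false, sub_zero, Pi.single_apply]

end SignSeparated

section Rank

variable {X : Type*} [MetricSpace X] {f : X → ℝ}

theorem SignSeparated.card_le_tightRank {ι Γ : Type*} [Fintype ι] [AddCommGroup Γ] {c : X → Γ}
    {x : ι → X} (hx : SignSeparated (c ∘ x))
    (hc : ∀ x y, f x + f y = dist x y → c x + c y = 0) :
    (Fintype.card ι : ℕ∞) ≤ tightRank (tightPairs f) := by
  classical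
  let w : ι → tightDirection f := fun i => ⟨fun y => oddIndicator (c (x i)) (c y),
    mem_tightDirection.2 fun y z hyz => by
      rw [eq_neg_of_add_eq_zero_right (hc y z hyz), oddIndicator_neg, add_neg_cancel]⟩
  let restrict := LinearMap.funLeft ℝ ℝ x ∘ₗ (tightDirection f).subtype
  have hsingle : restrict ∘ w = fun i => Pi.single i 1 :=
    funext fun i => funext fun j => hx.oddIndicator_apply i j
  have hw : LinearIndependent ℝ w :=
    .of_comp restrict (hsingle ▸ Pi.linearIndependent_single_one ι ℝ)
  simpa [tightRank, Cardinal.natCast_le_toENat] using hw.cardinal_lift_le_rank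

end Rank

section IntegralMetric

theorem forall_le_add_of_isChain {X : Type*} {D : X → X → ℕ} {c : Set (X → ℕ)}
    (hc : IsChain (· ≤ ·) c) (hD : ∀ F ∈ c, ∀ x y, D x y ≤ F x + F y) (hne : c.Nonempty) (x y : X) :
    D x y ≤ sInf ((· x) '' c) + sInf ((· y) '' c) := by
  obtain ⟨F, hF, hFx⟩ := Nat.sInf_mem (hne.image (· x))
  obtain ⟨F', hF', hFy⟩ := Nat.sInf_mem (hne.image (· y))
  rw [← hFx, ← hFy]
  rcases hc.total hF hF' with h | h
  · exact (hD F hF x y).trans (Nat.add_le_add_left (h y) _)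
  · exact (hD F' hF' x y).trans (Nat.add_le_add_right (h x) _)

theorem exists_le_minimal_cover {X : Type*} {D : X → X → ℕ} {G₀ : X → ℕ}
    (hG₀ : ∀ x y, D x y ≤ G₀ x + G₀ y) :
    ∃ G ≤ G₀, Minimal (fun G : X → ℕ => ∀ x y, D x y ≤ G x + G y) G := by
  refine zorn_le_nonempty₀ (α := (X → ℕ)ᵒᵈ) {G : X → ℕ | ∀ x y, D x y ≤ G x + G y}
    (fun c hcover hc G hG => ?_) G₀ hG₀
  have hinf : ∀ x y, D x y ≤ sInf ((· x) '' c) + sInf ((· y) '' c) :=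
    forall_le_add_of_isChain hc.symm hcover ⟨G, hG⟩
  exact ⟨_, hinf, fun F hF x => Nat.sInf_le ⟨F, hF, rfl⟩⟩

theorem exists_add_eq_of_minimal {X : Type*} {D : X → X → ℕ} (hD : ∀ x, D x x = 0)
    (hsymm : ∀ x y, D x y = D y x) {G : X → ℕ}
    (hG : Minimal (fun G : X → ℕ => ∀ x y, D x y ≤ G x + G y) G) (x : X) :
    ∃ y, G x + G y = D x y := by
  classical
  by_contra! hne
  have hlt : ∀ y, D x y < G x + G y := fun y => (hG.prop x y).lt_of_ne (hne y).symm
  have hpos : 0 < G x := by have := hlt x; omega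
  have hcover : ∀ a b, D a b ≤
      Function.update G x (G x - 1) a + Function.update G x (G x - 1) b := by
    intro a b
    have hab := hG.prop a b
    have ha := hlt a
    have hb := hlt b
    rw [hsymm] at ha
    by_cases hax : a = x <;> by_cases hbx : b = x <;>
      simp only [hax, hbx, Function.update_self, Function.update_of_ne, ne_eq, not_false_eq_true,
        hD] at hab ha hb ⊢ <;> omega
  have hle : G x ≤ Function.update G x (G x - 1) x :=
    hG.le_of_le hcover (update_le_self_iff.2 (Nat.sub_le _ _)) x
  rw [Function.update_self] at hle
  omega

variable {X : Type*} [MetricSpace X]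

theorem natCast_floor_dist (hint : ∀ x y : X, ∃ n : ℤ, dist x y = n) (x y : X) :
    (⌊dist x y⌋₊ : ℝ) = dist x y := by
  obtain ⟨n, hn⟩ := hint x y
  lift n to ℕ using by exact_mod_cast hn ▸ dist_nonneg
  rw [hn, Int.cast_natCast, Nat.floor_natCast]

theorem isTightExtremal_natCast_div (hint : ∀ x y : X, ∃ n : ℤ, dist x y = n) {n : ℕ} (hn : 0 < n)
    {G : X → ℕ} (hG : Minimal (fun G : X → ℕ => ∀ x y, n * ⌊dist x y⌋₊ ≤ G x + G y) G) :
    IsTightExtremal fun x => (G x : ℝ) / n := by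
  have hn' : (0 : ℝ) < n := Nat.cast_pos.2 hn
  refine isTightExtremal_iff.2 ⟨fun x y => ?_, fun x => ?_⟩
  · rw [← add_div, le_div_iff₀' hn', ← natCast_floor_dist hint]
    exact_mod_cast hG.prop x y
  · obtain ⟨y, hy⟩ := exists_add_eq_of_minimal (fun x => by simp) (fun x y => by rw [dist_comm])
      hG x
    refine ⟨y, ?_⟩
    rw [← add_div, div_eq_iff hn'.ne', ← natCast_floor_dist hint, mul_comm]
    exact_mod_cast hy

theorem IsExtremal.exists_isTightExtremal_near (hint : ∀ x y : X, ∃ n : ℤ, dist x y = n)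
    {f : X → ℝ} (hf : IsExtremal f) (k : ℕ) :
    ∃ g : X → ℝ, IsTightExtremal g ∧ ∀ x, |f x - g x| ≤ 1 / ((k : ℝ) + 1) := by
  have hk : (0 : ℝ) < (k + 1 : ℕ) := by positivity
  have hceil : ∀ x y, (k + 1) * ⌊dist x y⌋₊ ≤ ⌈(k + 1 : ℕ) * f x⌉₊ + ⌈(k + 1 : ℕ) * f y⌉₊ := by
    intro x y
    have h : (k + 1 : ℕ) * dist x y ≤ ⌈(k + 1 : ℕ) * f x⌉₊ + ⌈(k + 1 : ℕ) * f y⌉₊ :=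
      calc (k + 1 : ℕ) * dist x y ≤ (k + 1 : ℕ) * (f x + f y) := by
            gcongr; exact hf.dist_le_add x y
        _ = (k + 1 : ℕ) * f x + (k + 1 : ℕ) * f y := mul_add ..
        _ ≤ _ := add_le_add (Nat.le_ceil _) (Nat.le_ceil _)
    rw [← natCast_floor_dist hint] at h
    exact_mod_cast h
  obtain ⟨G, hGle, hG⟩ := exists_le_minimal_cover hceil
  have hg := isTightExtremal_natCast_div hint k.succ_pos hG
  refine ⟨_, hg, hf.abs_sub_le hg.1 fun x => ?_⟩
  rw [← Nat.cast_add_one, ← sub_le_iff_le_add, ← sub_div, div_le_iff₀ hk, sub_le_iff_le_add,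
    mul_comm (f x)]
  calc (G x : ℝ) ≤ ⌈(k + 1 : ℕ) * f x⌉₊ := Nat.cast_le.2 (hGle x)
    _ ≤ (k + 1 : ℕ) * f x + 1 := (Nat.ceil_lt_add_one (mul_nonneg hk.le (hf.nonneg x))).le

theorem supDist_le {X : Type*} {f g : X → ℝ} {ε : ℝ} (hε : 0 ≤ ε) (h : ∀ x, |f x - g x| ≤ ε) :
    supDist f g ≤ ε :=
  Real.iSup_le h hε

theorem finite_setOf_eq_neg_unitAddCircle : {a : UnitAddCircle | a = -a}.Finite := by
  simpa only [two_nsmul, eq_neg_iff_add_eq_zero] using AddCircle.finite_torsion (1 : ℝ) two_pos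

theorem coe_dist_eq_zero (hint : ∀ x y : X, ∃ n : ℤ, dist x y = n) (x y : X) :
    (dist x y : UnitAddCircle) = 0 := by
  obtain ⟨n, hn⟩ := hint x y
  exact (AddCircle.coe_eq_zero_iff 1).2 ⟨n, hn ▸ zsmul_one n⟩

theorem coe_add_coe_eq_zero_of_add_eq_dist (hint : ∀ x y : X, ∃ n : ℤ, dist x y = n) {f : X → ℝ}
    {x y : X} (h : f x + f y = dist x y) : (f x : UnitAddCircle) + (f y : UnitAddCircle) = 0 := by
  rw [← AddCircle.coe_add, h, coe_dist_eq_zero hint]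

theorem IsExtremal.finite_range_coe (hint : ∀ x y : X, ∃ n : ℤ, dist x y = n)
    (hLRC : LocalRankCondition X) {f : X → ℝ} (hf : IsExtremal f) :
    (Set.range fun x => (f x : UnitAddCircle)).Finite := by
  obtain ⟨ε, hε, N, hN⟩ := hLRC f hf
  choose g hg hgf using hf.exists_isTightExtremal_near hint
  have hlim₀ : Tendsto (fun k : ℕ => 1 / ((k : ℝ) + 1)) atTop (𝓝 0) :=
    tendsto_one_div_add_atTop_nhds_zero_nat
  have hlim : Tendsto (fun k x => (g k x : UnitAddCircle)) atTop
      (𝓝 fun x => (f x : UnitAddCircle)) := by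
    refine tendsto_pi_nhds.2 fun x => ((AddCircle.continuous_mk' (1 : ℝ)).tendsto (f x)).comp ?_
    refine tendsto_iff_dist_tendsto_zero.2 (squeeze_zero (fun _ => dist_nonneg) (fun k => ?_) hlim₀)
    exact dist_comm (f x) (g k x) ▸ hgf k x
  refine finite_range_of_signSeparated_le finite_setOf_eq_neg_unitAddCircle (N := N)
    fun m x hx => ?_
  have hsep : ∀ᶠ k in atTop, SignSeparated fun i => (g k (x i) : UnitAddCircle) :=
    hx.eventually (tendsto_pi_nhds.2 fun i => tendsto_pi_nhds.1 hlim (x i))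
  obtain ⟨k, hk, hkε⟩ := (hsep.and (hlim₀.eventually_lt_const hε)).exists
  have hrank : tightRank (tightPairs (g k)) ≤ N :=
    hN (g k) (hg k) ((supDist_le (by positivity) (hgf k)).trans_lt hkε)
  have hcard := SignSeparated.card_le_tightRank (c := fun x => (g k x : UnitAddCircle)) hk
    fun x y => coe_add_coe_eq_zero_of_add_eq_dist hint
  rw [Fintype.card_fin] at hcard
  exact_mod_cast hcard.trans hrank

theorem mem_of_isLUB_of_finite_image_coe {S : Set ℝ} {a : ℝ} (ha : IsLUB S a)
    (hS : ((fun t : ℝ => (t : UnitAddCircle)) '' S).Finite) : a ∈ S := by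
  obtain ⟨b, hbS, hb, -⟩ := ha.exists_between (sub_one_lt a)
  have hinj : Set.InjOn (fun t : ℝ => (t : UnitAddCircle)) (S ∩ Set.Ici b) := by
    have hmem : ∀ t ∈ S ∩ Set.Ici b, t ∈ Set.Ico b (b + 1) := fun t ht =>
      ⟨ht.2, (ha.1 ht.1).trans_lt (sub_lt_iff_lt_add.1 hb)⟩
    exact fun s hs t ht => (AddCircle.coe_eq_coe_iff_of_mem_Ico (hmem s hs) (hmem t ht)).1
  have hfin : (S ∩ Set.Ici b).Finite :=
    .of_finite_image (hS.subset (Set.image_mono Set.inter_subset_left)) hinj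
  exact ((ha.inter_Ici_of_mem hbS).mem_of_isClosed ⟨b, hbS, Set.self_mem_Ici⟩ hfin.isClosed).1

theorem IsExtremal.isTightExtremal (hint : ∀ x y : X, ∃ n : ℤ, dist x y = n)
    (hLRC : LocalRankCondition X) {f : X → ℝ} (hf : IsExtremal f) : IsTightExtremal f := by
  refine isTightExtremal_iff.2 ⟨hf.dist_le_add, fun x => ?_⟩
  have hfin : ((fun t : ℝ => (t : UnitAddCircle)) '' Set.range fun y => dist x y - f y).Finite := by
    refine ((hf.finite_range_coe hint hLRC).image Neg.neg).subset ?_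
    rintro _ ⟨_, ⟨y, rfl⟩, rfl⟩
    exact ⟨_, ⟨y, rfl⟩, by simp only [AddCircle.coe_sub, coe_dist_eq_zero hint, zero_sub]⟩
  obtain ⟨y, hy⟩ := mem_of_isLUB_of_finite_image_coe (hf x) hfin
  exact ⟨y, (sub_eq_iff_eq_add.1 hy).symm⟩

theorem LocalRankCondition.tightRank_lt_top (hLRC : LocalRankCondition X) {f : X → ℝ}
    (hf : IsTightExtremal f) : tightRank (tightPairs f) < ⊤ := by
  obtain ⟨ε, hε, N, hN⟩ := hLRC f hf.isExtremal
  have hself : supDist f f < ε := by simpa [supDist] using hε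
  exact (hN f hf hself).trans_lt (ENat.natCast_lt_top N)

end IntegralMetric

section Polytope

variable {V W : Type*} [AddCommGroup V] [Module ℝ V] [AddCommGroup W] [Module ℝ W]

theorem eq_of_mem_extremePoints_of_active {κ : Type*} [Finite κ] {φ : κ → Module.Dual ℝ V}
    {b : κ → ℝ} {v w : V} (hv : v ∈ {u | ∀ k, b k ≤ φ k u}.extremePoints ℝ)
    (hw : ∀ k, b k ≤ φ k w) (hvw : ∀ k, φ k v = b k → φ k w = b k) : w = v := by
  have hbeyond : ∀ k, ∀ᶠ t in 𝓝[>] (0 : ℝ), b k ≤ φ k (v + t • (v - w)) := by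
    intro k
    rcases (hv.1 k).eq_or_lt with hk | hk
    · exact .of_forall fun t => by simp [← hk, hvw k hk.symm]
    · have hlim : Tendsto (fun t : ℝ => φ k (v + t • (v - w))) (𝓝[>] 0) (𝓝 (φ k v)) := by
        simp only [map_add, map_smul, smul_eq_mul]
        exact (Continuous.tendsto' (by fun_prop) 0 _ (by simp)).mono_left nhdsWithin_le_nhds
      exact (hlim.eventually_const_lt hk).mono fun t ht => ht.le
  obtain ⟨t, ht, htpos : 0 < t⟩ := ((eventually_all.2 hbeyond).and self_mem_nhdsWithin).exists
  refine (mem_extremePoints_iff_left.1 hv).2 w hw _ ht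
    ⟨t / (1 + t), 1 / (1 + t), by positivity, by positivity, by field_simp; ring, ?_⟩
  match_scalars <;> field_simp
  ring

theorem finite_extremePoints_setOf_forall_le {κ : Type*} [Finite κ] (φ : κ → Module.Dual ℝ V)
    (b : κ → ℝ) : ({w | ∀ k, b k ≤ φ k w}.extremePoints ℝ).Finite := by
  refine .of_finite_image (f := fun v => {k | φ k v = b k}) (Set.toFinite _) ?_
  exact fun v hv w hw hvw => (eq_of_mem_extremePoints_of_active hv hw.1 hvw.subset).symm

theorem setOf_forall_le_eq_setOf_forall_range {ι : Type*} {φ : ι → Module.Dual ℝ V} {b : ι → ℝ}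
    (hne : {w | ∀ i, b i ≤ φ i w}.Nonempty) :
    {w | ∀ i, b i ≤ φ i w} =
      {w | ∀ ψ : Set.range φ, (⨆ i : φ ⁻¹' {ψ.1}, b i) ≤ ψ.1 w} := by
  obtain ⟨v, hv⟩ := hne
  have hbdd : ∀ ψ, BddAbove (b '' (φ ⁻¹' {ψ})) := by
    refine fun ψ => ⟨ψ v, ?_⟩
    rintro _ ⟨i, rfl, rfl⟩
    exact hv i
  have hsup : ∀ i r, (⨆ j : φ ⁻¹' {φ i}, b j) ≤ r ↔ ∀ j ∈ φ ⁻¹' {φ i}, b j ≤ r := fun i _ =>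
    ciSup_set_le_iff (s := φ ⁻¹' {φ i}) ⟨i, rfl⟩ (hbdd _)
  ext w
  simp only [Set.mem_ofPred_eq, Subtype.forall, Set.forall_mem_range, hsup]
  exact ⟨fun h i j hj => Set.mem_singleton_iff.1 hj ▸ h j, fun h i => h i i rfl⟩

theorem isPolytope_setOf_forall_le [TopologicalSpace V] [IsTopologicalAddGroup V]
    [ContinuousSMul ℝ V] [T2Space V] [LocallyConvexSpace ℝ V] {ι : Type*}
    {φ : ι → Module.Dual ℝ V} {b : ι → ℝ} (hφ : (Set.range φ).Finite)
    (hcompact : IsCompact {w | ∀ i, b i ≤ φ i w}) : IsPolytope {w | ∀ i, b i ≤ φ i w} := by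
  rcases Set.eq_empty_or_nonempty {w | ∀ i, b i ≤ φ i w} with hempty | hne
  · exact ⟨∅, Set.finite_empty, by rw [hempty, convexHull_empty]⟩
  have hfin : ({w | ∀ i, b i ≤ φ i w}.extremePoints ℝ).Finite := by
    have : Finite (Set.range φ) := hφ
    rw [setOf_forall_le_eq_setOf_forall_range hne]
    exact finite_extremePoints_setOf_forall_le _ _
  have hconvex : Convex ℝ {w | ∀ i, b i ≤ φ i w} := by
    simpa only [Set.ofPred_forall] using
      convex_iInter fun i => convex_halfSpace_ge (φ i).isLinear (b i)
  refine ⟨_, hfin, ?_⟩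
  rw [← (hfin.isClosed_convexHull ℝ).closure_eq, closure_convexHull_extremePoints hcompact hconvex]

theorem IsPolytope.convex {P : Set V} (hP : IsPolytope P) : Convex ℝ P := by
  obtain ⟨S, -, rfl⟩ := hP
  exact convex_convexHull ℝ S

theorem IsPolytope.affine_image {P : Set V} (hP : IsPolytope P) (L : V →ᵃ[ℝ] W) :
    IsPolytope (L '' P) := by
  obtain ⟨S, hS, rfl⟩ := hP
  exact ⟨L '' S, hS.image L, L.image_convexHull S⟩

theorem convex_affine_image_iff {L : V →ᵃ[ℝ] W} {P F : Set V} (hP : Convex ℝ P)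
    (hL : Set.InjOn L P) (hF : F ⊆ P) : Convex ℝ (L '' F) ↔ Convex ℝ F := by
  refine ⟨fun h => convex_iff_segment_subset.2 fun x hx y hy z hz => ?_, fun h => h.affine_image L⟩
  have hLz : L z ∈ L '' F := h.segment_subset ⟨x, hx, rfl⟩ ⟨y, hy, rfl⟩
    (image_segment ℝ L x y ▸ ⟨z, hz, rfl⟩)
  exact (hL.mem_image_iff hF (hP.segment_subset (hF hx) (hF hy) hz)).1 hLz

theorem isExtreme_affine_image_iff {L : V →ᵃ[ℝ] W} {P F : Set V} (hP : Convex ℝ P)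
    (hL : Set.InjOn L P) (hF : F ⊆ P) : IsExtreme ℝ (L '' P) (L '' F) ↔ IsExtreme ℝ P F := by
  refine ⟨fun h => ⟨hF, fun x hx y hy z hz hzxy => ?_⟩, fun h => ⟨Set.image_mono hF, ?_⟩⟩
  · refine (hL.mem_image_iff hF hx).1 (h.2 ⟨x, hx, rfl⟩ ⟨y, hy, rfl⟩ ⟨z, hz, rfl⟩ ?_)
    exact image_openSegment ℝ L x y ▸ ⟨z, hzxy, rfl⟩
  · rintro _ ⟨x, hx, rfl⟩ _ ⟨y, hy, rfl⟩ _ ⟨z, hz, rfl⟩ hzxy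
    rw [← image_openSegment, hL.mem_image_iff (hP.openSegment_subset hx hy) (hF hz)] at hzxy
    exact ⟨x, h.2 hx hy hz hzxy, rfl⟩

theorem isFace_affine_image_iff {L : V →ᵃ[ℝ] W} {P F : Set V} (hP : Convex ℝ P)
    (hL : Set.InjOn L P) (hF : F ⊆ P) : IsFace (L '' P) (L '' F) ↔ IsFace P F :=
  and_congr (convex_affine_image_iff hP hL hF) (isExtreme_affine_image_iff hP hL hF)

theorem IsPolytope.isPolytopeIso_image {L : V →ᵃ[ℝ] W} {P : Set V} (hP : IsPolytope P)
    (hL : Set.InjOn L (affineSpan ℝ P)) : IsPolytopeIso L P (L '' P) where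
  isPolytope_source := hP
  isPolytope_target := hP.affine_image L
  injOn := hL
  image_eq := rfl
  face_iff _ hF :=
    (isFace_affine_image_iff hP.convex (hL.mono (subset_affineSpan ℝ P)) hF).symm

theorem injOn_affineSpan_of_leftInvOn {L : V →ᵃ[ℝ] W} {R : W →ᵃ[ℝ] V} {P : Set V}
    (h : Set.LeftInvOn R L P) : Set.InjOn L (affineSpan ℝ P) := by
  have hid : Set.EqOn (R.comp L) (AffineMap.id ℝ V) P := h
  exact Set.LeftInvOn.injOn (f₁' := R) (AffineMap.eqOn_affineSpan hid)

end Polytope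

section CellPolytope

variable {X : Type*} [MetricSpace X] {f : InjHull X}

theorem image_val_cell (hf : IsTightExtremal f.1) :
    Subtype.val '' cell f = {g | (∀ x y, dist x y ≤ g x + g y) ∧
      ∀ x y, f.1 x + f.1 y = dist x y → g x + g y = dist x y} := by
  ext g
  constructor
  · rintro ⟨g, hg, rfl⟩
    exact ⟨g.2.dist_le_add, mem_tightSubspace.1 hg⟩
  · rintro ⟨hcover, htight⟩
    have hg : IsTightExtremal g := isTightExtremal_iff.2
      ⟨hcover, fun x => (hf.exists_tight x).imp fun y => htight x y⟩
    exact ⟨⟨g, hg.isExtremal⟩, mem_tightSubspace.2 htight, rfl⟩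

theorem isClosed_image_val_cell (hf : IsTightExtremal f.1) : IsClosed (Subtype.val '' cell f) := by
  rw [image_val_cell hf]
  simp only [Set.ofPred_and, Set.ofPred_forall]
  refine .inter (isClosed_iInter fun x => isClosed_iInter fun y => ?_)
    (isClosed_iInter fun x => isClosed_iInter fun y => isClosed_iInter fun _ => ?_)
  · exact isClosed_le continuous_const (by fun_prop)
  · exact isClosed_eq (by fun_prop) continuous_const

theorem isCompact_image_val_cell (hf : IsTightExtremal f.1) :
    IsCompact (Subtype.val '' cell f) := by
  choose y hy using hf.exists_tight
  refine (isCompact_univ_pi fun x => isCompact_Icc (a := 0) (b := dist x (y x))).of_isClosed_subset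
    (isClosed_image_val_cell hf) ?_
  rintro _ ⟨g, hg, rfl⟩ x -
  have htight := mem_tightSubspace.1 hg x (y x) (hy x)
  exact ⟨g.2.nonneg x, by linarith [g.2.nonneg (y x)]⟩

/-- The coordinate `w ↦ w x` as a functional on the direction of `H(A(f))`. -/
def tightCoord (f : X → ℝ) (x : X) : Module.Dual ℝ (tightDirection f) :=
  LinearMap.proj x ∘ₗ (tightDirection f).subtype

theorem finite_range_tightCoord {f : X → ℝ} (hrank : tightRank (tightPairs f) < ⊤) :
    (Set.range (tightCoord f)).Finite := by
  obtain ⟨N, hN⟩ := ENat.ne_top_iff_exists.1 hrank.ne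
  have htors : {φ : Module.Dual ℝ (tightDirection f) | φ = -φ}.Finite := by
    have : IsAddTorsionFree (Module.Dual ℝ (tightDirection f)) := .of_isTorsionFree ℝ _
    simp only [self_eq_neg, Set.ofPred_eq_eq_singleton, Set.finite_singleton]
  refine finite_range_of_signSeparated_le htors (N := N) fun m x hx => ?_
  have hcard := hx.card_le_tightRank (f := f) fun x y hxy =>
    LinearMap.ext fun w => mem_tightDirection.1 w.2 x y hxy
  rw [Fintype.card_fin, ← hN] at hcard
  exact_mod_cast hcard

/-- The affine parametrization `w ↦ w + f` of `H(A(f))` by its direction. -/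
def tightParam (f : X → ℝ) : tightDirection f →ᵃ[ℝ] (X → ℝ) :=
  (tightDirection f).subtype.toAffineMap + AffineMap.const ℝ _ f

theorem isClosedEmbedding_tightParam {f : X → ℝ} (hrank : tightRank (tightPairs f) < ⊤) :
    IsClosedEmbedding (tightParam f) := by
  have := finiteDimensional_tightDirection hrank
  exact (Homeomorph.addRight f).isClosedEmbedding.comp
    (Submodule.closed_of_finiteDimensional _).isClosedEmbedding_subtypeVal

theorem image_val_cell_subset_range_tightParam :
    Subtype.val '' cell f ⊆ Set.range (tightParam f.1) := by
  rintro _ ⟨g, hg, rfl⟩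
  have hself : f.1 ∈ tightSubspace (tightPairs f.1) := mem_tightSubspace.2 fun _ _ h => h
  exact ⟨⟨_, AffineSubspace.vsub_mem_direction hg hself⟩, sub_add_cancel _ _⟩

theorem preimage_tightParam_image_val_cell (hf : IsTightExtremal f.1) :
    tightParam f.1 ⁻¹' (Subtype.val '' cell f) =
      {w | ∀ p : X × X, dist p.1 p.2 - (f.1 p.1 + f.1 p.2) ≤
        (tightCoord f.1 p.1 + tightCoord f.1 p.2) w} := by
  ext w
  have hparam : ∀ x y, tightParam f.1 w x + tightParam f.1 w y =
      (tightCoord f.1 x + tightCoord f.1 y) w + (f.1 x + f.1 y) :=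
    fun x y => add_add_add_comm (w.1 x) (f.1 x) (w.1 y) (f.1 y)
  have htight : ∀ x y, f.1 x + f.1 y = dist x y →
      (tightCoord f.1 x + tightCoord f.1 y) w + (f.1 x + f.1 y) = dist x y := fun x y hxy => by
    rw [hxy, add_eq_right]
    exact mem_tightDirection.1 w.2 x y hxy
  simp only [image_val_cell hf, Set.mem_preimage, Set.mem_ofPred_eq, Prod.forall,
    sub_le_iff_le_add, hparam]
  exact and_iff_left htight

theorem isPolytope_image_val_cell (hf : IsTightExtremal f.1)
    (hrank : tightRank (tightPairs f.1) < ⊤) : IsPolytope (Subtype.val '' cell f) := by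
  have hcoord := finite_range_tightCoord hrank
  have hrange : (Set.range fun p : X × X => tightCoord f.1 p.1 + tightCoord f.1 p.2).Finite := by
    refine (hcoord.add hcoord).subset ?_
    rintro _ ⟨p, rfl⟩
    exact Set.add_mem_add ⟨p.1, rfl⟩ ⟨p.2, rfl⟩
  have hcompact : IsCompact (tightParam f.1 ⁻¹' (Subtype.val '' cell f)) :=
    (isClosedEmbedding_tightParam hrank).isCompact_preimage (isCompact_image_val_cell hf)
  have hpreimage : IsPolytope (tightParam f.1 ⁻¹' (Subtype.val '' cell f)) := by
    rw [preimage_tightParam_image_val_cell hf] at hcompact ⊢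
    exact isPolytope_setOf_forall_le hrange hcompact
  rw [← Set.image_preimage_eq_of_subset image_val_cell_subset_range_tightParam]
  exact hpreimage.affine_image _

end CellPolytope

section Antipodal

variable {Y : Type*} [MetricSpace Y]

theorem eq_of_dist_eq_add_dist {p q q' : Y} (h : dist p q = dist p q' + dist q' q)
    (h' : dist p q' = dist p q + dist q q') : q = q' := by
  rw [dist_comm q' q] at h
  exact dist_eq_zero.1 (by linarith)

theorem IsExtremal.add_eq_dist_of_antipodal {φ : Y → ℝ} (hφ : IsExtremal φ) {p q : Y}
    (h : ∀ r, dist p q = dist p r + dist r q) : φ p + φ q = dist p q := by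
  refine le_antisymm (le_sub_iff_add_le.1 ((hφ p).2 ?_)) (hφ.dist_le_add p q)
  rintro _ ⟨r, rfl⟩
  have hLip := hφ.le_add_dist q r
  rw [dist_comm] at hLip
  linarith [h r]

end Antipodal

section Gates

variable {X : Type*} [MetricSpace X]

theorem InjHull.abs_sub_le_dist (g h : InjHull X) (x : X) : |g.1 x - h.1 x| ≤ dist g h :=
  le_ciSup (g.2.bddAbove_abs_sub h.2) x

theorem InjHull.dist_le {g h : InjHull X} {r : ℝ} (hr : 0 ≤ r) (hgh : ∀ x, |g.1 x - h.1 x| ≤ r) :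
    dist g h ≤ r :=
  supDist_le hr hgh

theorem InjHull.dist_embed (x : X) (g : InjHull X) : dist (InjHull.embed x) g = g.1 x := by
  refine le_antisymm (InjHull.dist_le (g.2.nonneg x) fun y => ?_) ?_
  · have hLip := g.2.le_add_dist y x
    rw [dist_comm] at hLip
    exact abs_le.2 ⟨by linarith! [g.2.dist_le_add x y], by linarith! [g.2.dist_le_add x y]⟩
  · have h := InjHull.abs_sub_le_dist (InjHull.embed x) g x
    simp only [InjHull.embed, dist_self, zero_sub, abs_neg] at h
    exact (le_abs_self _).trans h

variable {f : InjHull X}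

/-- The set `G([f])` of gates of the cell of `f`. -/
abbrev cellGates (f : InjHull X) : Set (InjHull X) :=
  gates (InjHull.embed : X → InjHull X) (cell f)

theorem mem_cell_of_mem_cellGates (γ : cellGates f) : γ.1 ∈ cell f :=
  γ.2.elim fun _ hγ => hγ.1

theorem IsGate.apply_eq {x : X} {γ g : InjHull X} (hγ : IsGate InjHull.embed (cell f) x γ)
    (hg : g ∈ cell f) : g.1 x = γ.1 x + dist γ g := by
  simpa only [InjHull.dist_embed] using hγ.2 g hg

theorem IsGate.unique {x : X} {γ γ' : InjHull X} (h : IsGate InjHull.embed (cell f) x γ)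
    (h' : IsGate InjHull.embed (cell f) x γ') : γ = γ' :=
  eq_of_dist_eq_add_dist (h'.2 γ h.1) (h.2 γ' h'.1)

theorem IsGate.dist_eq_add_dist {x y : X} (hxy : f.1 x + f.1 y = dist x y) {γ γ' g : InjHull X}
    (hγ : IsGate InjHull.embed (cell f) x γ) (hγ' : IsGate InjHull.embed (cell f) y γ')
    (hg : g ∈ cell f) : dist γ γ' = dist γ g + dist g γ' := by
  have hgxy := mem_tightSubspace.1 hg x y hxy
  have hγxy := mem_tightSubspace.1 hγ'.1 x y hxy
  rw [dist_comm g γ']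
  linarith [hγ.apply_eq hg, hγ'.apply_eq hg, hγ.apply_eq hγ'.1]

theorem exists_antipode (hf : IsTightExtremal f.1)
    (hgated : IsGated (InjHull.embed : X → InjHull X) (cell f)) (γ : cellGates f) :
    ∃ γ' : cellGates f, ∀ g ∈ cell f, dist γ.1 γ'.1 = dist γ.1 g + dist g γ'.1 := by
  obtain ⟨γ, x, hγ⟩ := γ
  obtain ⟨y, hxy⟩ := hf.exists_tight x
  obtain ⟨γ', hγ'⟩ := hgated y
  exact ⟨⟨γ', y, hγ'⟩, fun g hg => hγ.dist_eq_add_dist hxy hγ' hg⟩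

theorem isAntipodal_cellGates (hf : IsTightExtremal f.1)
    (hgated : IsGated (InjHull.embed : X → InjHull X) (cell f)) :
    IsAntipodal (cellGates f) := by
  choose σ hσ using exists_antipode hf hgated
  have hσ' : ∀ γ γ' : cellGates f, dist γ (σ γ) = dist γ γ' + dist γ' (σ γ) :=
    fun γ γ' => hσ γ γ'.1 (mem_cell_of_mem_cellGates γ')
  refine ⟨σ, fun γ => eq_of_dist_eq_add_dist (hσ' (σ γ) γ) ?_, hσ'⟩
  rw [dist_comm (σ γ) γ, hσ' γ (σ (σ γ)), dist_comm γ, dist_comm (σ γ), add_comm]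

/-- The gate `γ^x` of `x` in the cell of `f`. -/
noncomputable def gateOf (hgated : IsGated (InjHull.embed : X → InjHull X) (cell f)) (x : X) :
    cellGates f :=
  ⟨(hgated x).choose, x, (hgated x).choose_spec⟩

theorem isGate_gateOf (hgated : IsGated (InjHull.embed : X → InjHull X) (cell f)) (x : X) :
    IsGate InjHull.embed (cell f) x (gateOf hgated x).1 :=
  (hgated x).choose_spec

theorem IsGate.gateOf_eq (hgated : IsGated (InjHull.embed : X → InjHull X) (cell f)) {x : X}
    {γ : cellGates f} (hγ : IsGate InjHull.embed (cell f) x γ.1) : gateOf hgated x = γ :=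
  Subtype.ext ((isGate_gateOf hgated x).unique hγ)

/-- A point whose gate in the cell of `f` is `γ`. -/
noncomputable def gatePoint (γ : cellGates f) : X :=
  γ.2.choose

theorem isGate_gatePoint (γ : cellGates f) : IsGate InjHull.embed (cell f) (gatePoint γ) γ.1 :=
  γ.2.choose_spec

end Gates

section HullOfGates

variable {X : Type*} [MetricSpace X] {f : InjHull X}

/-- The affine map `g ↦ (γ^x ↦ g(x) - γ^x(x))` extending `Φ` to all of `ℝ^X`; off the cell it
depends on the choice of `x` for each gate. -/
noncomputable def gateCoords (f : InjHull X) : (X → ℝ) →ᵃ[ℝ] (cellGates f → ℝ) :=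
  (LinearMap.funLeft ℝ ℝ (gatePoint : cellGates f → X)).toAffineMap -
    AffineMap.const ℝ (X → ℝ) fun γ : cellGates f => γ.1.1 (gatePoint γ)

/-- The affine map `φ ↦ (x ↦ φ(γ^x) + γ^x(x))`, which restricts to the inverse of `Φ`. -/
noncomputable def gateLift (hgated : IsGated (InjHull.embed : X → InjHull X) (cell f)) :
    (cellGates f → ℝ) →ᵃ[ℝ] (X → ℝ) :=
  (LinearMap.funLeft ℝ ℝ (gateOf hgated)).toAffineMap +
    AffineMap.const ℝ (cellGates f → ℝ) fun x : X => (gateOf hgated x).1.1 x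

theorem gateCoords_apply (g : X → ℝ) (γ : cellGates f) :
    gateCoords f g γ = g (gatePoint γ) - γ.1.1 (gatePoint γ) :=
  rfl

theorem gateCoords_apply_of_mem_cell {g : InjHull X} (hg : g ∈ cell f) (γ : cellGates f) :
    gateCoords f g.1 γ = dist γ.1 g :=
  sub_eq_of_eq_add' ((isGate_gatePoint γ).apply_eq hg)

theorem gateLift_apply (hgated : IsGated (InjHull.embed : X → InjHull X) (cell f))
    (φ : cellGates f → ℝ) (x : X) :
    gateLift hgated φ x = φ (gateOf hgated x) + (gateOf hgated x).1.1 x :=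
  rfl

theorem gateLift_gateCoords (hgated : IsGated (InjHull.embed : X → InjHull X) (cell f))
    {g : InjHull X} (hg : g ∈ cell f) : gateLift hgated (gateCoords f g.1) = g.1 := by
  ext x
  rw [gateLift_apply, gateCoords_apply_of_mem_cell hg, (isGate_gateOf hgated x).apply_eq hg,
    add_comm]

theorem gateCoords_gateLift (hgated : IsGated (InjHull.embed : X → InjHull X) (cell f))
    (φ : cellGates f → ℝ) : gateCoords f (gateLift hgated φ) = φ := by
  ext γ
  rw [gateCoords_apply, gateLift_apply, (isGate_gatePoint γ).gateOf_eq hgated, add_sub_cancel_right]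

theorem isExtremal_gateCoords (hf : IsTightExtremal f.1)
    (hgated : IsGated (InjHull.embed : X → InjHull X) (cell f)) {g : InjHull X}
    (hg : g ∈ cell f) : IsExtremal (gateCoords f g.1) := by
  refine IsTightExtremal.isExtremal (isTightExtremal_iff.2 ⟨fun γ γ' => ?_, fun γ => ?_⟩)
  · rw [gateCoords_apply_of_mem_cell hg, gateCoords_apply_of_mem_cell hg, dist_comm γ'.1]
    exact dist_triangle γ.1 g γ'.1
  · obtain ⟨γ', hγ'⟩ := exists_antipode hf hgated γ
    refine ⟨γ', ?_⟩
    rw [gateCoords_apply_of_mem_cell hg, gateCoords_apply_of_mem_cell hg, dist_comm γ'.1]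
    exact (hγ' g hg).symm

theorem gateLift_mem_image_val_cell (hf : IsTightExtremal f.1)
    (hgated : IsGated (InjHull.embed : X → InjHull X) (cell f)) {φ : cellGates f → ℝ}
    (hφ : IsExtremal φ) : gateLift hgated φ ∈ Subtype.val '' cell f := by
  rw [image_val_cell hf]
  have hgate := isGate_gateOf hgated
  refine ⟨fun x y => ?_, fun x y hxy => ?_⟩
  · have hle : dist (gateOf hgated x).1 (gateOf hgated y).1 ≤ _ := hφ.dist_le_add _ _
    have hcover := (gateOf hgated y).1.2.dist_le_add x y
    rw [gateLift_apply, gateLift_apply]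
    linarith [(hgate x).apply_eq (hgate y).1]
  · have heq : _ = dist (gateOf hgated x).1 (gateOf hgated y).1 :=
      hφ.add_eq_dist_of_antipodal fun γ =>
        (hgate x).dist_eq_add_dist hxy (hgate y) (mem_cell_of_mem_cellGates γ)
    have htight := mem_tightSubspace.1 (hgate y).1 x y hxy
    rw [gateLift_apply, gateLift_apply]
    linarith [(hgate x).apply_eq (hgate y).1]

theorem image_gateCoords_image_val_cell (hf : IsTightExtremal f.1)
    (hgated : IsGated (InjHull.embed : X → InjHull X) (cell f)) :
    gateCoords f '' (Subtype.val '' cell f) = Set.range fun φ : InjHull (cellGates f) => φ.1 := by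
  refine Set.Subset.antisymm ?_ ?_
  · rintro _ ⟨_, ⟨g, hg, rfl⟩, rfl⟩
    exact ⟨⟨_, isExtremal_gateCoords hf hgated hg⟩, rfl⟩
  · rintro _ ⟨φ, rfl⟩
    exact ⟨_, gateLift_mem_image_val_cell hf hgated φ.2, gateCoords_gateLift hgated φ.1⟩

theorem injOn_gateCoords (hgated : IsGated (InjHull.embed : X → InjHull X) (cell f)) :
    Set.InjOn (gateCoords f) (affineSpan ℝ (Subtype.val '' cell f)) := by
  refine injOn_affineSpan_of_leftInvOn (R := gateLift hgated) ?_
  rintro _ ⟨g, hg, rfl⟩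
  exact gateLift_gateCoords hgated hg

/-- The map `Φ` from the cell of `f` to the injective hull of its gates. -/
noncomputable def cellToHull (hf : IsTightExtremal f.1)
    (hgated : IsGated (InjHull.embed : X → InjHull X) (cell f)) (g : cell f) :
    InjHull (cellGates f) :=
  ⟨gateCoords f g.1.1, isExtremal_gateCoords hf hgated g.2⟩

theorem isometry_cellToHull (hf : IsTightExtremal f.1)
    (hgated : IsGated (InjHull.embed : X → InjHull X) (cell f)) :
    Isometry (cellToHull hf hgated) := by
  refine .of_dist_eq fun g h => le_antisymm (InjHull.dist_le dist_nonneg fun γ => ?_)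
    (InjHull.dist_le dist_nonneg fun x => ?_)
  · change |gateCoords f g.1.1 γ - gateCoords f h.1.1 γ| ≤ _
    rw [gateCoords_apply, gateCoords_apply, sub_sub_sub_cancel_right]
    exact InjHull.abs_sub_le_dist g.1 h.1 (gatePoint γ)
  · rw [← gateLift_gateCoords hgated g.2, ← gateLift_gateCoords hgated h.2, gateLift_apply,
      gateLift_apply, add_sub_add_right_eq_sub]
    exact InjHull.abs_sub_le_dist (cellToHull hf hgated g) (cellToHull hf hgated h) _

theorem surjective_cellToHull (hf : IsTightExtremal f.1)
    (hgated : IsGated (InjHull.embed : X → InjHull X) (cell f)) :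
    Function.Surjective (cellToHull hf hgated) := by
  intro φ
  obtain ⟨g, hg, hgφ⟩ := gateLift_mem_image_val_cell hf hgated φ.2
  exact ⟨⟨g, hg⟩, Subtype.ext <|
    (congrArg (gateCoords f) hgφ).trans (gateCoords_gateLift hgated φ.1)⟩

/-- The isometry `Φ` between a gated cell and the injective hull of its gates. -/
noncomputable def cellIsometryEquivHull (hf : IsTightExtremal f.1)
    (hgated : IsGated (InjHull.embed : X → InjHull X) (cell f)) :
    cell f ≃ᵢ InjHull (cellGates f) where
  toEquiv := .ofBijective (cellToHull hf hgated)
    ⟨(isometry_cellToHull hf hgated).injective, surjective_cellToHull hf hgated⟩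
  isometry_toFun := isometry_cellToHull hf hgated

end HullOfGates

theorem theorem3_general {X : Type*} [MetricSpace X] (f : InjHull X) (hf : IsTightExtremal f.1)
    (hrank : tightRank (tightPairs f.1) < ⊤)
    (hgated : IsGated (InjHull.embed : X → InjHull X) (cell f)) :
    IsAntipodal (cellGates f) ∧
    ∃ Φ : cell f ≃ᵢ InjHull (cellGates f),
      (∀ (g : cell f) (x : X) (γ : cellGates f),
        IsGate InjHull.embed (cell f) x γ.1 → (Φ g).1 γ = g.1.1 x - γ.1.1 x) ∧
      ∃ L : (X → ℝ) →ᵃ[ℝ] (cellGates f → ℝ),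
        (∀ g : cell f, L g.1.1 = (Φ g).1) ∧
        IsPolytopeIso L (Subtype.val '' cell f)
          (Set.range fun φ : InjHull (cellGates f) => φ.1) := by
  refine ⟨isAntipodal_cellGates hf hgated, cellIsometryEquivHull hf hgated, fun g x γ hγ => ?_,
    gateCoords f, fun _ => rfl, ?_⟩
  · rw [hγ.apply_eq g.2, add_sub_cancel_left]
    exact gateCoords_apply_of_mem_cell g.2 γ
  · rw [← image_gateCoords_image_val_cell hf hgated]
    exact (isPolytope_image_val_cell hf hrank).isPolytopeIso_image (injOn_gateCoords hgated)

theorem theorem3 {X : Type*} [MetricSpace X]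
    (hint : ∀ x y : X, ∃ n : ℤ, dist x y = n)
    (hLRC : LocalRankCondition X)
    (f : InjHull X)
    (hgated : IsGated (InjHull.embed : X → InjHull X) (cell f)) :
    IsAntipodal (gates (InjHull.embed : X → InjHull X) (cell f)) ∧
    ∃ Φ : cell f ≃ᵢ InjHull (gates (InjHull.embed : X → InjHull X) (cell f)),
      (∀ (g : cell f) (x : X) (γ : gates (InjHull.embed : X → InjHull X) (cell f)),
        IsGate InjHull.embed (cell f) x γ.1 → (Φ g).1 γ = g.1.1 x - γ.1.1 x) ∧
      ∃ L : (X → ℝ) →ᵃ[ℝ] (gates (InjHull.embed : X → InjHull X) (cell f) → ℝ),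
        (∀ g : cell f, L g.1.1 = (Φ g).1) ∧
        IsPolytopeIso L (Subtype.val '' cell f)
          (Set.range fun h : InjHull (gates (InjHull.embed : X → InjHull X) (cell f)) => h.1) := by
  have hf := f.2.isTightExtremal hint hLRC
  exact theorem3_general f hf (hLRC.tightRank_lt_top hf) hgated
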